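/- Let $\mathcal{L}$ be an algebraic signature with at least one constant symbol and let $\mathcal{V}$ be a variety of $\mathcal{L}$-algebras, i.e. the class of all $\mathcal{L}$-algebras satisfying some fixed set of equations. For sets of equations $\Gamma,\Delta$, write $\Gamma\models_{\mathcal{V}}\Delta$ if for every $\mathbf{A}\in\mathcal{V}$, every assignment of the variables in $\mathbf{A}$ that satisfies all equations of $\Gamma$ also satisfies all equations of $\Delta$. Write $\Gamma(\overline{x},\overline{y})$ to indicate that the variables of $\Gamma$ are among $\overline{x},\overline{y}$, where $\overline{x},\overline{y},\overline{z}$ always denote pairwise disjoint sets of variables. The variety $\mathcal{V}$ admits *left uniform Maehara interpolation* if for any finite sets $\overline{y},\overline{z}$ and finite sets of equations $\Sigma(\overline{y},\overline{z}),\Delta(\overline{y},\overline{z})$ there exists a finite set of equations $\Pi(\overline{y})$ such that for any set $\overline{x}$ and any finite set of equations $\Gamma(\overline{x},\overline{y})$, $$\Gamma,\Sigma\models_{\mathcal{V}}\Delta\iff\Gamma\models_{\mathcal{V}}\Pi .$$ $\mathcal{V}$ has the *amalgamation property* if for all $\mathbf{A},\mathbf{B},\mathbf{C}\in\mathcal{V}$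 and embeddings $i\colon\mathbf{A}\to\mathbf{B}$, $j\colon\mathbf{A}\to\mathbf{C}$ there are $\mathbf{D}\in\mathcal{V}$ and embeddings $h\colon\mathbf{B}\to\mathbf{D}$, $k\colon\mathbf{C}\to\mathbf{D}$ with $hi=kj$. It has the *congruence extension property* if every congruence on a subalgebra of an algebra $\mathbf{A}\in\mathcal{V}$ is the restriction of a congruence on $\mathbf{A}$. For an algebra $\mathbf{A}$, let $\mathrm{KCon}\,\mathbf{A}$ be the set of compact elements of the lattice of congruences on $\mathbf{A}$, ordered by inclusion. The *compact lifting* of a homomorphism $h\colon\mathbf{A}\to\mathbf{B}$ is the map $h^*\colon\mathrm{KCon}\,\mathbf{A}\to\mathrm{KCon}\,\mathbf{B}$ sending $\psi$ to the congruence on $\mathbf{B}$ generated by $\{(h(a),h(a')):(a,a')\in\psi\}$; it *has a left adjoint* if there is a map $g\colon\mathrm{KCon}\,\mathbf{B}\to\mathrm{KCon}\,\mathbf{A}$ such that $g(\theta)\subseteq\psi\iff\theta\subseteq h^*(\psi)$ for all $\theta\in\mathrm{KCon}\,\mathbf{B}$ and $\psi\in\mathrm{KCon}\,\mathbf{A}$.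 An algebra $\mathbf{A}\in\mathcal{V}$ is *finitely presented* if there are a finite set $\overline{x}$ and a surjective homomorphism onto $\mathbf{A}$ from the $\mathcal{V}$-free algebra $\mathbf{F}(\overline{x})$ whose kernel is a compact congruence. **Theorem.** The following are equivalent: 1. $\mathcal{V}$ admits left uniform Maehara interpolation. 2. $\mathcal{V}$ has the amalgamation property and the congruence extension property, and the compact lifting of any homomorphism between finitely presented algebras in $\mathcal{V}$ has a left adjoint. -/

import Mathlib

open scoped FirstOrder

universe u v w w'

namespace UnivAlg

/-! An algebraic signature is a first-order language without relation symbols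
(`[L.IsAlgebraic]`); algebras are its structures, terms are its terms. -/

/-- The `L`-equations over a set `X` of variables: ordered pairs of terms. -/
abbrev Equation (L : FirstOrder.Language.{u, v}) (X : Type w) := L.Term X × L.Term X

/-- Rename the variables of an equation along `g`. -/
def Equation.rename {L : FirstOrder.Language.{u, v}} {X : Type w} {Y : Type w'} (g : X → Y)
    (e : Equation L X) : Equation L Y :=
  (e.1.relabel g, e.2.relabel g)

/-- The assignment `f : X → A` satisfies the equation `e`. -/
def Satisfies {L : FirstOrder.Language.{u, v}} {X : Type w} (A : Type w') [L.Structure A] (f : X → A)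
    (e : Equation L X) : Prop :=
  e.1.realize f = e.2.realize f

/-- A variety of `L`-algebras, presented by a set of defining equations. -/
structure Variety (L : FirstOrder.Language.{u, v}) where
  /-- The defining equations, over a countably infinite set of variables. -/
  equations : Set (Equation L ℕ)

/-- The algebra `A` belongs to the variety `V`: every defining equation holds in `A` under every
assignment. -/
def Variety.Mem {L : FirstOrder.Language.{u, v}} (V : Variety L) (A : Type w) [L.Structure A] : Prop :=
  ∀ e ∈ V.equations, ∀ f : ℕ → A, Satisfies A f e

/-- Equational consequence `Σ ⊨_V Δ`: for every algebra `A` of `V` and every assignment of the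
variables in `A`, if all equations of `Σ` are satisfied then so are all equations of `Δ`. -/
def Variety.Entails {L : FirstOrder.Language.{u, v}} (V : Variety L) {X : Type u}
    (S D : Set (Equation L X)) : Prop :=
  ∀ (A : Type u) [L.Structure A], V.Mem A → ∀ f : X → A,
    (∀ e ∈ S, Satisfies A f e) → ∀ e ∈ D, Satisfies A f e

/-- Left uniform Maehara interpolation. Disjoint unions of sets of variables are sum types. -/
def Variety.LeftUniformMaehara {L : FirstOrder.Language.{u, v}} (V : Variety L) : Prop :=
  ∀ (Y Z : Type u) [Finite Y] [Finite Z] (S D : Set (Equation L (Y ⊕ Z))),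
    S.Finite → D.Finite →
    ∃ P : Set (Equation L Y), P.Finite ∧
      ∀ (X : Type u) (G : Set (Equation L (X ⊕ Y))), G.Finite →
        (V.Entails
            (Equation.rename (Sum.map id Sum.inl : X ⊕ Y → X ⊕ (Y ⊕ Z)) '' G ∪
              Equation.rename (Sum.inr : Y ⊕ Z → X ⊕ (Y ⊕ Z)) '' S)
            (Equation.rename (Sum.inr : Y ⊕ Z → X ⊕ (Y ⊕ Z)) '' D) ↔
          V.Entails G (Equation.rename (Sum.inr : Y → X ⊕ Y) '' P))

/-- The amalgamation property for `V`. -/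
def Variety.Amalgamation {L : FirstOrder.Language.{u, v}} (V : Variety L) : Prop :=
  ∀ (A B C : Type u) [L.Structure A] [L.Structure B] [L.Structure C],
    V.Mem A → V.Mem B → V.Mem C → ∀ (i : A ↪[L] B) (j : A ↪[L] C),
      ∃ (D : Type u) (_ : L.Structure D) (h : B ↪[L] D) (k : C ↪[L] D),
        V.Mem D ∧ h.comp i = k.comp j

/-- A congruence on an `L`-algebra: an equivalence relation compatible with all operations. -/
structure Congruence (L : FirstOrder.Language.{u, v}) (A : Type w) [L.Structure A] extends Setoid A where
  map_rel' : ∀ {n : ℕ} (f : L.Functions n) (a b : Fin n → A),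
    (∀ i, r (a i) (b i)) →
      r (FirstOrder.Language.Structure.funMap f a) (FirstOrder.Language.Structure.funMap f b)

/-- `V` has the congruence extension property: every congruence on a subalgebra `S` of an algebra
`A` of `V` is the restriction to `S` of a congruence on `A`. -/
def Variety.CongruenceExtension {L : FirstOrder.Language.{u, v}} (V : Variety L) : Prop :=
  ∀ (A : Type u) [L.Structure A], V.Mem A → ∀ (S : L.Substructure A) (θ : Congruence L S),
    ∃ φ : Congruence L A, ∀ a b : S, φ.r (a : A) (b : A) ↔ θ.r a b

namespace Congruence

variable {L : FirstOrder.Language.{u, v}} {A : Type w} [L.Structure A] {B : Type w'} [L.Structure B]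

theorem ext_r {θ ψ : Congruence L A} (h : ∀ a b, θ.r a b ↔ ψ.r a b) : θ = ψ := by
  obtain ⟨s, _⟩ := θ
  obtain ⟨t, _⟩ := ψ
  have : s = t := Setoid.ext h
  subst this
  rfl

/-- Congruences are ordered by inclusion. -/
instance : PartialOrder (Congruence L A) where
  le θ ψ := ∀ a b, θ.r a b → ψ.r a b
  le_refl _ _ _ h := h
  le_trans _ _ _ h₁ h₂ a b h := h₂ a b (h₁ a b h)
  le_antisymm _ _ h₁ h₂ := ext_r fun a b => ⟨h₁ a b, h₂ a b⟩

/-- The infimum of a set of congruences is its intersection. -/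
instance : InfSet (Congruence L A) where
  sInf s :=
    { r := fun a b => ∀ θ ∈ s, θ.r a b
      iseqv :=
        ⟨fun a θ _ => θ.iseqv.refl a, fun h θ hθ => θ.iseqv.symm (h θ hθ),
          fun h₁ h₂ θ hθ => θ.iseqv.trans (h₁ θ hθ) (h₂ θ hθ)⟩
      map_rel' := fun f a b h θ hθ => θ.map_rel' f a b fun i => h i θ hθ }

/-- The complete lattice of congruences on `A`. -/
instance : CompleteLattice (Congruence L A) :=
  completeLatticeOfInf _ fun _ =>
    ⟨fun θ hθ _ _ h => h θ hθ, fun _ hψ a b h _ hθ => hψ hθ a b h⟩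

/-- The congruence on `A` generated by a set of pairs. -/
def cg (S : Set (A × A)) : Congruence L A :=
  sInf {θ | ∀ p ∈ S, θ.r p.1 p.2}

theorem cg_le_iff {S : Set (A × A)} {θ : Congruence L A} :
    cg S ≤ θ ↔ ∀ p ∈ S, θ.r p.1 p.2 :=
  ⟨fun h p hp => h _ _ fun _ hψ => hψ p hp, fun h _ _ hab => hab θ h⟩

/-- The quotient of `A` by a congruence is an `L`-algebra (via `Language.quotientStructure`). -/
instance prestructure [L.IsAlgebraic] (θ : Congruence L A) : L.Prestructure θ.toSetoid where
  toStructure := inferInstance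
  fun_equiv {_ f} x y h := θ.map_rel' f x y h
  rel_equiv {_ r} := isEmptyElim r

/-- The quotient algebra `A / θ`. -/
abbrev Quot [L.IsAlgebraic] (θ : Congruence L A) : Type w := Quotient θ.toSetoid

/-- The inverse image lifting `h⁻¹` of a homomorphism `h`. -/
def comap (h : A →[L] B) (θ : Congruence L B) : Congruence L A where
  r a b := θ.r (h a) (h b)
  iseqv := ⟨fun a => θ.iseqv.refl (h a), fun hab => θ.iseqv.symm hab,
    fun hab hbc => θ.iseqv.trans hab hbc⟩
  map_rel' f a b hab := by
    rw [FirstOrder.Language.Hom.map_fun, FirstOrder.Language.Hom.map_fun]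
    exact θ.map_rel' f _ _ hab

/-- The direct image lifting `h*` of a homomorphism `h`: the congruence on `B` generated by the
image of a congruence on `A`. -/
def map (h : A →[L] B) (ψ : Congruence L A) : Congruence L B :=
  cg {p | ∃ a a' : A, ψ.r a a' ∧ p = (h a, h a')}

theorem map_le_iff (h : A →[L] B) (ψ : Congruence L A) (θ : Congruence L B) :
    map h ψ ≤ θ ↔ ψ ≤ comap h θ := by
  rw [map, cg_le_iff]
  refine ⟨fun H a b hab => H _ ⟨a, b, hab, rfl⟩, ?_⟩
  rintro H _ ⟨a, b, hab, rfl⟩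
  exact H a b hab

/-- The kernel of a homomorphism. -/
def ker (h : A →[L] B) : Congruence L A where
  r a b := h a = h b
  iseqv := ⟨fun _ => rfl, fun hab => hab.symm, fun hab hbc => hab.trans hbc⟩
  map_rel' f a b hab := by
    rw [FirstOrder.Language.Hom.map_fun, FirstOrder.Language.Hom.map_fun]
    exact congrArg _ (funext hab)

/-- A directed supremum of congruences is their union. -/
theorem exists_of_sSup_directed {s : Set (Congruence L A)} (hne : s.Nonempty)
    (hdir : DirectedOn (· ≤ ·) s) {a b : A} (hab : (sSup s).r a b) : ∃ θ ∈ s, θ.r a b := by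
  let U : Congruence L A :=
    { r := fun a b => ∃ θ ∈ s, θ.r a b
      iseqv := by
        refine ⟨fun a => ?_, ?_, ?_⟩
        · obtain ⟨θ, hθ⟩ := hne
          exact ⟨θ, hθ, θ.iseqv.refl a⟩
        · rintro x y ⟨θ, hθ, h⟩
          exact ⟨θ, hθ, θ.iseqv.symm h⟩
        · rintro x y z ⟨θ, hθ, h⟩ ⟨ψ, hψ, h'⟩
          obtain ⟨χ, hχ, h₁, h₂⟩ := hdir θ hθ ψ hψ
          exact ⟨χ, hχ, χ.iseqv.trans (h₁ _ _ h) (h₂ _ _ h')⟩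
      map_rel' := by
        intro n f x y h
        choose t ht hxy using h
        have : Nonempty s := hne.to_subtype
        obtain ⟨m, hm⟩ := (directedOn_iff_directed.1 hdir).finite_le
          (fun i : Fin n => (⟨t i, ht i⟩ : s))
        exact ⟨m, m.2, m.1.map_rel' f x y fun i => hm i _ _ (hxy i)⟩ }
  have hU : sSup s ≤ U := sSup_le fun θ hθ a b h => ⟨θ, hθ, h⟩
  exact hU a b hab

/-- The direct image lifting preserves compact congruences. -/
theorem isCompactElement_map (h : A →[L] B) {ψ : Congruence L A} (hψ : IsCompactElement ψ) :
    IsCompactElement (map h ψ) := by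
  rw [CompleteLattice.isCompactElement_iff_le_of_directed_sSup_le] at hψ ⊢
  intro s hne hdir hle
  have hmono : ∀ θ θ' : Congruence L B, θ ≤ θ' → comap h θ ≤ comap h θ' :=
    fun _ _ H a b hab => H _ _ hab
  obtain ⟨_, ⟨θ, hθ, rfl⟩, hle'⟩ := hψ (comap h '' s) (hne.image _) (by
      rintro _ ⟨θ, hθ, rfl⟩ _ ⟨θ', hθ', rfl⟩
      obtain ⟨χ, hχ, h₁, h₂⟩ := hdir θ hθ θ' hθ'
      exact ⟨_, ⟨χ, hχ, rfl⟩, hmono _ _ h₁, hmono _ _ h₂⟩) (by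
      intro a b hab
      obtain ⟨θ, hθ, h'⟩ := exists_of_sSup_directed hne hdir ((map_le_iff h ψ _).1 hle a b hab)
      have hθle : comap h θ ≤ sSup (comap h '' s) := le_sSup ⟨θ, hθ, rfl⟩
      exact hθle a b h')
  exact ⟨θ, hθ, (map_le_iff h ψ θ).2 hle'⟩

end Congruence

/-- The join-semilattice `KCon A` of compact congruences on `A`, ordered by inclusion. -/
abbrev KCon (L : FirstOrder.Language.{u, v}) (A : Type w) [L.Structure A] :=
  {θ : Congruence L A // IsCompactElement θ}

/-- The compact lifting of `h`: the restriction of `h*` to compact congruences. -/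
def compactLifting {L : FirstOrder.Language.{u, v}} {A : Type w} [L.Structure A] {B : Type w'}
    [L.Structure B] (h : A →[L] B) : KCon L A → KCon L B :=
  fun ψ => ⟨Congruence.map h ψ.1, Congruence.isCompactElement_map h ψ.2⟩

/-- A type synonym for the set of terms, carrying the structure of the term algebra `T(X)`. -/
def TermAlgebra (L : FirstOrder.Language.{u, v}) (X : Type w) : Type (max u w) := L.Term X

instance (L : FirstOrder.Language.{u, v}) [L.IsAlgebraic] (X : Type w) : L.Structure (TermAlgebra L X) where
  funMap f t := FirstOrder.Language.Term.func f t
  RelMap r _ := isEmptyElim r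

/-- The congruence on the term algebra whose quotient is the free algebra of `V`: the least
congruence with quotient in `V`. -/
def Variety.freeCongruence {L : FirstOrder.Language.{u, v}} [L.IsAlgebraic] (V : Variety L) (X : Type w) :
    Congruence L (TermAlgebra L X) :=
  sInf {θ | V.Mem θ.Quot}

/-- The `V`-free algebra `F(X)`: the largest quotient of the term algebra that lies in `V`. -/
abbrev Variety.Free {L : FirstOrder.Language.{u, v}} [L.IsAlgebraic] (V : Variety L) (X : Type w) :
    Type (max u w) :=
  (V.freeCongruence X).Quot

/-- `A` is a finitely presented algebra of `V`: it lies in `V` and there is a surjective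
homomorphism `F(X) → A` with `X` finite and compact kernel. -/
def Variety.FinitelyPresented {L : FirstOrder.Language.{u, v}} [L.IsAlgebraic] (V : Variety L) (A : Type u)
    [L.Structure A] : Prop :=
  V.Mem A ∧ ∃ (X : Type u) (_ : Finite X) (p : V.Free X →[L] A),
    Function.Surjective p ∧ IsCompactElement (Congruence.ker p)

/-- The compact lifting of every homomorphism between finitely presented algebras of `V` has a
left adjoint. -/
def Variety.CompactLiftingsHaveLeftAdjoints {L : FirstOrder.Language.{u, v}} [L.IsAlgebraic]
    (V : Variety L) : Prop :=
  ∀ (A B : Type u) [L.Structure A] [L.Structure B],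
    V.FinitelyPresented A → V.FinitelyPresented B → ∀ f : A →[L] B,
      ∃ g : KCon L B → KCon L A, GaloisConnection g (compactLifting f)

end UnivAlg

open FirstOrder.Language Set

namespace UnivAlg

/-! ### Satisfaction under renamings and homomorphisms -/

section Basic

variable {L : FirstOrder.Language.{u, v}} {X : Type w} {Y : Type w'}

/-! The middle term is `InjectionsTransferable`: any span of an injection `i : A → B` and a
homomorphism `j : A → C` completes to a square whose map out of `C` is injective. This is equivalent
to amalgamation together with congruence extension.

Interpolation gives transferability. Impose the diagrams of `B` and `C`, glued along `A`. If they
force `c = c'`, then finitely many of their equations do, and an interpolant in variables from `A`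
holds in `B`, hence in `A` because `i` is injective, hence in `C`, where it yields `c = c'`.
Conversely, transferability gives interpolants: the algebra presented by the `y`-consequences of `Γ`
embeds in the one presented by `Γ`, and this injection transfers to any algebra satisfying those
consequences together with `Σ`.

Uniformity is the adjunction. Over a presentation, compact congruences are finite sets of equations
and inclusion is consequence (`IsPresentation.cg_le_cg_iff`). If `f` sends the generators `y` to
terms `t(z)`, a left adjoint to its compact lifting is a choice of `Π(y)` entailed by exactly those
`Γ(y)` which, with `y = t(z)` and the relations of the codomain, entail `Δ`. This is the uniform
property with `x` empty; ordinary interpolation extends it to all `Γ(x, y)`. -/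

theorem satisfies_rename {A : Type*} [L.Structure A] (f : Y → A) (g : X → Y) (e : Equation L X) :
    Satisfies A f (e.rename g) ↔ Satisfies A (f ∘ g) e := by
  simp [Satisfies, Equation.rename, Term.realize_relabel]

theorem Satisfies.map {A B : Type*} [L.Structure A] [L.Structure B] {f : X → A} {e : Equation L X}
    (he : Satisfies A f e) (h : A →[L] B) : Satisfies B (h ∘ f) e := by
  simp only [Satisfies, HomClass.realize_term] at he ⊢
  rw [he]

theorem satisfies_comp_iff {A B : Type*} [L.Structure A] [L.Structure B] (f : X → A)
    (e : Equation L X) {h : A →[L] B} (hh : Function.Injective h) :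
    Satisfies B (h ∘ f) e ↔ Satisfies A f e := by
  simp only [Satisfies, HomClass.realize_term]
  exact hh.eq_iff

theorem Variety.Mem.of_injective {V : Variety L} {A B : Type*} [L.Structure A] [L.Structure B]
    (hB : V.Mem B) (h : A →[L] B) (hh : Function.Injective h) : V.Mem A :=
  fun e he f => (satisfies_comp_iff f e hh).1 (hB e he _)

theorem Variety.Mem.of_surjective {V : Variety L} {A B : Type*} [L.Structure A] [L.Structure B]
    (hA : V.Mem A) (h : A →[L] B) (hh : Function.Surjective h) : V.Mem B := by
  intro e he f
  have := (hA e he (Function.surjInv hh ∘ f)).map h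
  rwa [← Function.comp_assoc, Function.comp_surjInv hh, Function.id_comp] at this

/-- The pair of values of the two sides of an equation under an assignment. -/
def Equation.eval {A : Type*} [L.Structure A] (a : X → A) (e : Equation L X) : A × A :=
  (e.1.realize a, e.2.realize a)

end Basic

/-! ### Compact congruences and quotient algebras -/

namespace Congruence

variable {L : FirstOrder.Language.{u, v}} {A : Type w} [L.Structure A] {B : Type w'} [L.Structure B]

theorem cg_mono {S T : Set (A × A)} (h : S ⊆ T) : cg (L := L) S ≤ cg T :=
  cg_le_iff.2 fun p hp => cg_le_iff.1 le_rfl p (h hp)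

theorem rel_cg {S : Set (A × A)} {p : A × A} (hp : p ∈ S) : (cg (L := L) S).r p.1 p.2 :=
  cg_le_iff.1 le_rfl p hp

theorem map_cg (h : A →[L] B) (S : Set (A × A)) : map h (cg S) = cg (Prod.map h h '' S) := by
  apply eq_of_forall_ge_iff
  intro θ
  rw [map_le_iff, cg_le_iff, cg_le_iff, forall_mem_image]
  rfl

theorem isCompactElement_cg {S : Set (A × A)} (hS : S.Finite) : IsCompactElement (cg (L := L) S) := by
  rw [CompleteLattice.isCompactElement_iff_le_of_directed_sSup_le]
  intro s hne hdir hle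
  have hmem : ∀ p : S, ∃ θ : s, θ.1.r p.1.1 p.1.2 := fun p =>
    let ⟨θ, hθ, h⟩ := exists_of_sSup_directed hne hdir (hle _ _ (rel_cg p.2))
    ⟨⟨θ, hθ⟩, h⟩
  choose t ht using hmem
  have := hne.to_subtype
  have := hS.to_subtype
  obtain ⟨m, hm⟩ := (directedOn_iff_directed.1 hdir).finite_le t
  exact ⟨m, m.2, cg_le_iff.2 fun p hp => hm ⟨p, hp⟩ _ _ (ht _)⟩

/-- A congruence is the directed supremum of the congruences generated by its finite subsets, so a
compact one lies below, and hence equals, one of these. -/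
theorem isCompactElement_iff {θ : Congruence L A} :
    IsCompactElement θ ↔ ∃ S : Set (A × A), S.Finite ∧ θ = cg S := by
  refine ⟨fun h => ?_, fun ⟨S, hS, h⟩ => h ▸ isCompactElement_cg hS⟩
  rw [CompleteLattice.isCompactElement_iff_le_of_directed_sSup_le] at h
  obtain ⟨_, ⟨S, ⟨hS, hle⟩, rfl⟩, hθ⟩ :=
    h (cg '' {S : Set (A × A) | S.Finite ∧ ∀ p ∈ S, θ.r p.1 p.2}) ⟨_, ∅, by simp, rfl⟩ (by
      rintro _ ⟨S, ⟨hS, hS'⟩, rfl⟩ _ ⟨T, ⟨hT, hT'⟩, rfl⟩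
      exact ⟨_, ⟨S ∪ T, ⟨hS.union hT, fun p hp => hp.elim (hS' p) (hT' p)⟩, rfl⟩,
        cg_mono subset_union_left, cg_mono subset_union_right⟩) (by
      intro a b hab
      have hmem : cg (L := L) {(a, b)} ∈
          cg '' {S : Set (A × A) | S.Finite ∧ ∀ p ∈ S, θ.r p.1 p.2} :=
        ⟨_, ⟨finite_singleton _, by simpa using hab⟩, rfl⟩
      exact le_sSup hmem a b (rel_cg (p := (a, b)) rfl))
  exact ⟨S, hS, le_antisymm hθ (cg_le_iff.2 hle)⟩

theorem satisfies_comp_iff_ker {X : Type*} (h : A →[L] B) (f : X → A) (e : Equation L X) :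
    Satisfies B (h ∘ f) e ↔ (ker h).r (e.1.realize f) (e.2.realize f) := by
  rw [Satisfies, HomClass.realize_term, HomClass.realize_term]
  rfl

variable [L.IsAlgebraic]

/-- The canonical projection onto the quotient algebra. -/
def proj (θ : Congruence L A) : A →[L] θ.Quot where
  toFun a := Quotient.mk θ.toSetoid a
  map_fun' f x := (funMap_quotient_mk' θ.toSetoid f x).symm
  map_rel' r := isEmptyElim r

theorem proj_surjective (θ : Congruence L A) : Function.Surjective θ.proj := Quotient.mk_surjective

theorem proj_eq_iff (θ : Congruence L A) {a b : A} : θ.proj a = θ.proj b ↔ θ.r a b :=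
  Quotient.eq (r := θ.toSetoid)

theorem satisfies_proj_comp_iff {X : Type*} (θ : Congruence L A) (f : X → A) (e : Equation L X) :
    Satisfies θ.Quot (θ.proj ∘ f) e ↔ θ.r (e.1.realize f) (e.2.realize f) := by
  rw [Satisfies, HomClass.realize_term, HomClass.realize_term, θ.proj_eq_iff]

/-- A homomorphism factors through the quotient by any congruence below its kernel. -/
theorem exists_lift_of_surjective {C : Type*} [L.Structure C] (q : A →[L] B)
    (hq : Function.Surjective q) (h : A →[L] C) (hle : ker q ≤ ker h) :
    ∃ g : B →[L] C, ∀ a, g (q a) = h a := by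
  have key : ∀ a, h (Function.surjInv hq (q a)) = h a := fun a =>
    hle _ _ (Function.surjInv_eq hq (q a))
  refine ⟨{ toFun := h ∘ Function.surjInv hq, map_fun' := ?_, map_rel' := fun r => isEmptyElim r },
    key⟩
  intro n f x
  have hx : x = q ∘ (Function.surjInv hq ∘ x) := by
    rw [← Function.comp_assoc, Function.comp_surjInv hq, Function.id_comp]
  conv_lhs => rw [hx, ← q.map_fun, Function.comp_apply, key, h.map_fun]
  rfl

end Congruence

/-! ### Consequence as a congruence on terms -/

namespace Variety

variable {L : FirstOrder.Language.{u, v}} {X : Type u} {V : Variety L}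

theorem entails_iff_forall_singleton {S D : Set (Equation L X)} :
    V.Entails S D ↔ ∀ e ∈ D, V.Entails S {e} := by
  constructor
  · rintro h e he A _ hA f hf _ rfl
    exact h A hA f hf _ he
  · intro h A _ hA f hf e he
    exact h e he A hA f hf e rfl

theorem Entails.mono {S T D : Set (Equation L X)} (h : V.Entails S D) (hST : S ⊆ T) :
    V.Entails T D :=
  fun A _ hA f hf => h A hA f fun e he => hf e (hST he)

theorem entails_of_mem {S : Set (Equation L X)} {e : Equation L X} (he : e ∈ S) :
    V.Entails S {e} := by
  rintro A _ hA f hf _ rfl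
  exact hf _ he

/-- The congruence on the term algebra of all consequences of a set of equations. -/
def entailedCongruence [L.IsAlgebraic] (V : Variety L) (S : Set (Equation L X)) :
    Congruence L (TermAlgebra L X) where
  r s t := V.Entails S {((s, t) : L.Term X × L.Term X)}
  iseqv := by
    refine ⟨fun s A _ _ f _ => ?_, fun h A _ hA f hf => ?_, fun h h' A _ hA f hf => ?_⟩
    · simp [Satisfies]
    · have := h A hA f hf
      simp only [mem_singleton_iff, forall_eq, Satisfies] at this ⊢
      exact this.symm
    · have := h A hA f hf
      have := h' A hA f hf
      simp only [mem_singleton_iff, forall_eq, Satisfies] at *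
      simp_all
  map_rel' := by
    intro n F a b h A _ hA f hf
    have := fun i => h i A hA f hf
    simp only [mem_singleton_iff, forall_eq, Satisfies] at this ⊢
    exact congrArg (Structure.funMap F) (funext this)

/-- The generators of the term algebra. -/
def termVar [L.IsAlgebraic] (x : X) : TermAlgebra L X := Term.var x

theorem realize_termVar [L.IsAlgebraic] (t : L.Term X) :
    t.realize (termVar : X → TermAlgebra L X) = t := by
  induction t with
  | var => rfl
  | func f ts ih => exact congrArg (Term.func f) (funext ih)

theorem satisfies_proj_termVar_iff [L.IsAlgebraic] (θ : Congruence L (TermAlgebra L X))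
    (e : Equation L X) : Satisfies θ.Quot (θ.proj ∘ termVar) e ↔ θ.r e.1 e.2 := by
  rw [θ.satisfies_proj_comp_iff, realize_termVar, realize_termVar]

theorem realize_termAlgebra [L.IsAlgebraic] {Z : Type*} {A : Type*} [L.Structure A] (t : L.Term Z)
    (σ : Z → TermAlgebra L X) (f : X → A) :
    Term.realize f (Term.realize σ t : TermAlgebra L X) =
      t.realize fun z => Term.realize f (σ z : L.Term X) := by
  induction t with
  | var => rfl
  | func F ts ih => exact congrArg (Structure.funMap F) (funext ih)

theorem mem_quot_iff [L.IsAlgebraic] {A : Type*} [L.Structure A] (θ : Congruence L A) :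
    V.Mem θ.Quot ↔ ∀ e ∈ V.equations, ∀ f : ℕ → A, θ.r (e.1.realize f) (e.2.realize f) := by
  refine ⟨fun h e he f => (θ.satisfies_proj_comp_iff f e).1 (h e he _), fun h e he f => ?_⟩
  have := (θ.satisfies_proj_comp_iff (Function.surjInv θ.proj_surjective ∘ f) e).2 (h e he _)
  rwa [← Function.comp_assoc, Function.comp_surjInv, Function.id_comp] at this

/-- Consequences contain every substitution instance of a defining equation: evaluating the instance
evaluates the equation at a composite assignment. -/
theorem mem_quot_entailedCongruence [L.IsAlgebraic] (S : Set (Equation L X)) :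
    V.Mem (V.entailedCongruence S).Quot := by
  rw [mem_quot_iff]
  rintro e he σ A _ hA f hf _ rfl
  simp only [Satisfies, realize_termAlgebra]
  exact hA e he _

/-- Equational consequence is finitary. -/
theorem Entails.exists_finite [L.IsAlgebraic] {S : Set (Equation L X)} {e : Equation L X}
    (h : V.Entails S {e}) : ∃ T ⊆ S, T.Finite ∧ V.Entails T {e} := by
  let s : Set (Congruence L (TermAlgebra L X)) :=
    V.entailedCongruence '' {T | T ⊆ S ∧ T.Finite}
  have hne : s.Nonempty := ⟨_, ∅, by simp, rfl⟩
  have hdir : DirectedOn (· ≤ ·) s := by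
    rintro _ ⟨T, ⟨hT, hT'⟩, rfl⟩ _ ⟨U, ⟨hU, hU'⟩, rfl⟩
    exact ⟨_, ⟨T ∪ U, ⟨union_subset hT hU, hT'.union hU'⟩, rfl⟩,
      fun a b hab => Entails.mono hab subset_union_left,
      fun a b hab => Entails.mono hab subset_union_right⟩
  -- The supremum contains the consequences of `∅`, so its quotient lies in `V`; being a directed
  -- union, it relates only what some finite `T` entails.
  have hmem : V.Mem (sSup s).Quot := by
    rw [mem_quot_iff]
    intro d hd σ
    exact le_sSup (α := Congruence L (TermAlgebra L X)) (⟨∅, by simp, rfl⟩ : V.entailedCongruence ∅ ∈ s)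
      _ _ ((mem_quot_iff _).1 (mem_quot_entailedCongruence ∅) d hd σ)
  have hle : ∀ d ∈ S, (sSup s).r d.1 d.2 := fun d hd => by
    have hds : V.entailedCongruence {d} ∈ s := ⟨{d}, by simpa using hd, rfl⟩
    exact le_sSup hds d.1 d.2 (entails_of_mem (e := d) rfl)
  have := (satisfies_proj_termVar_iff _ e).1 (h _ hmem _
    (fun d hd => (satisfies_proj_termVar_iff _ d).2 (hle d hd)) e rfl)
  obtain ⟨_, ⟨T, ⟨hT, hT'⟩, rfl⟩, hr⟩ := Congruence.exists_of_sSup_directed hne hdir this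
  exact ⟨T, hT, hT', hr⟩

theorem Entails.exists_finite_of_finite [L.IsAlgebraic] {S D : Set (Equation L X)}
    (h : V.Entails S D) (hD : D.Finite) : ∃ T ⊆ S, T.Finite ∧ V.Entails T D := by
  have := fun e : D => (entails_iff_forall_singleton.1 h e.1 e.2).exists_finite
  choose T hT hT' hE using this
  have := hD.to_subtype
  refine ⟨⋃ e, T e, iUnion_subset hT, finite_iUnion hT', entails_iff_forall_singleton.2 fun e he =>
    (hE ⟨e, he⟩).mono (subset_iUnion T _)⟩

/-! ### Presentations by generators and relations -/

/-- `A`, generated by the family `a`, is presented within `V` by the equations `E`. -/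
structure IsPresentation (V : Variety L) {A : Type u} [L.Structure A] (a : X → A)
    (E : Set (Equation L X)) : Prop where
  mem : V.Mem A
  exists_realize_eq : ∀ b, ∃ t : L.Term X, t.realize a = b
  satisfies_iff : ∀ e, Satisfies A a e ↔ V.Entails E {e}

namespace IsPresentation

variable {A : Type u} [L.Structure A] {a : X → A} {E : Set (Equation L X)}

theorem satisfies (h : V.IsPresentation a E) {e : Equation L X} (he : e ∈ E) : Satisfies A a e :=
  (h.satisfies_iff e).2 (entails_of_mem he)

/-- The universal property: an equation true at `a` follows from `E`, hence is true at `d`, so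
evaluation of terms at `d` factors through evaluation at `a`. -/
theorem exists_lift [L.IsAlgebraic] (h : V.IsPresentation a E) {D : Type u} [L.Structure D]
    (hD : V.Mem D) (d : X → D) (hd : ∀ e ∈ E, Satisfies D d e) :
    ∃ g : A →[L] D, g ∘ a = d := by
  have hom : ∀ {C : Type u} [L.Structure C] (c : X → C), ∃ g : TermAlgebra L X →[L] C,
      ∀ t : L.Term X, g t = t.realize c := fun c =>
    ⟨{ toFun := fun t => Term.realize c t, map_fun' := fun _ _ => rfl,
       map_rel' := fun r => isEmptyElim r }, fun _ => rfl⟩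
  obtain ⟨q, hq⟩ := hom a
  obtain ⟨p, hp⟩ := hom d
  obtain ⟨g, hg⟩ := Congruence.exists_lift_of_surjective q (fun b => by
    obtain ⟨t, ht⟩ := h.exists_realize_eq b
    exact ⟨t, (hq t).trans ht⟩) p (by
    intro s t hst
    have hst' := (h.satisfies_iff (s, t)).1 (((hq s).symm.trans hst).trans (hq t)) D hD d hd _ rfl
    exact ((hp s).trans hst').trans (hp t).symm)
  refine ⟨g, funext fun x => ?_⟩
  have h₁ := hg (Term.var x : L.Term X)
  rw [hq, hp] at h₁
  exact h₁

theorem quotient [L.IsAlgebraic] (h : V.IsPresentation a E) (S : Set (Equation L X)) :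
    V.IsPresentation ((Congruence.cg (L := L) (Equation.eval a '' S)).proj ∘ a) (E ∪ S) where
  mem := h.mem.of_surjective _ (Congruence.proj_surjective _)
  exists_realize_eq b := by
    obtain ⟨b, rfl⟩ := Congruence.proj_surjective _ b
    obtain ⟨t, rfl⟩ := h.exists_realize_eq b
    exact ⟨t, HomClass.realize_term _⟩
  satisfies_iff e := by
    constructor
    · rintro he D _ hD d hd _ rfl
      obtain ⟨g, rfl⟩ := h.exists_lift hD d fun e he => hd e (.inl he)
      rw [Congruence.satisfies_proj_comp_iff] at he
      have hle : Congruence.cg (Equation.eval a '' S) ≤ Congruence.ker g := by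
        rw [Congruence.cg_le_iff]
        rintro _ ⟨e, he, rfl⟩
        have := hd e (.inr he)
        rwa [Satisfies, HomClass.realize_term, HomClass.realize_term] at this
      have := hle _ _ he
      rwa [Satisfies, HomClass.realize_term, HomClass.realize_term]
    · intro he
      refine he _ (h.mem.of_surjective _ (Congruence.proj_surjective _)) _ ?_ _ rfl
      rintro d (hd | hd)
      · exact (h.satisfies hd).map _
      · rw [Congruence.satisfies_proj_comp_iff]
        exact Congruence.rel_cg (p := d.eval a) ⟨d, hd, rfl⟩

/-- The dictionary between generated congruences and consequence, read off from the presentation of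
the quotient. -/
theorem rel_cg_iff [L.IsAlgebraic] (h : V.IsPresentation a E) (S : Set (Equation L X))
    (e : Equation L X) :
    (Congruence.cg (L := L) (Equation.eval a '' S)).r (e.1.realize a) (e.2.realize a) ↔
      V.Entails (E ∪ S) {e} := by
  rw [← (h.quotient S).satisfies_iff, Congruence.satisfies_proj_comp_iff]

theorem exists_finite_eq_cg (h : V.IsPresentation a E) {θ : Congruence L A}
    (hθ : IsCompactElement θ) :
    ∃ S : Set (Equation L X), S.Finite ∧ θ = Congruence.cg (Equation.eval a '' S) := by
  obtain ⟨T, hT, rfl⟩ := Congruence.isCompactElement_iff.1 hθ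
  have hsurj : Function.Surjective (Equation.eval (L := L) a) := fun p =>
    let ⟨s, hs⟩ := h.exists_realize_eq p.1
    let ⟨t, ht⟩ := h.exists_realize_eq p.2
    ⟨(s, t), Prod.ext hs ht⟩
  refine ⟨Function.surjInv hsurj '' T, hT.image _, ?_⟩
  rw [← image_comp, Function.comp_surjInv, image_id]

end IsPresentation

theorem isPresentation_entailedCongruence [L.IsAlgebraic] (V : Variety L)
    (S : Set (Equation L X)) :
    V.IsPresentation ((V.entailedCongruence S).proj ∘ termVar) S where
  mem := mem_quot_entailedCongruence S
  exists_realize_eq b := by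
    obtain ⟨t, rfl⟩ := Congruence.proj_surjective _ b
    exact ⟨t, (HomClass.realize_term _).trans (congrArg _ (realize_termVar t))⟩
  satisfies_iff e := satisfies_proj_termVar_iff _ e

theorem freeCongruence_eq [L.IsAlgebraic] (V : Variety L) (X : Type u) :
    V.freeCongruence X = V.entailedCongruence ∅ := by
  refine le_antisymm (sInf_le (mem_quot_entailedCongruence _)) (le_sInf fun θ hθ s t hst => ?_)
  exact (satisfies_proj_termVar_iff θ (s, t)).1
    (hst _ hθ (θ.proj ∘ termVar) (fun _ h => h.elim) _ rfl)

theorem isPresentation_free [L.IsAlgebraic] (V : Variety L) (X : Type u) :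
    V.IsPresentation ((V.freeCongruence X).proj ∘ termVar) ∅ := by
  rw [freeCongruence_eq]
  exact V.isPresentation_entailedCongruence ∅

theorem finitelyPresented_iff [L.IsAlgebraic] {A : Type u} [L.Structure A] :
    V.FinitelyPresented A ↔ ∃ (X : Type u) (_ : Finite X) (a : X → A) (E : Set (Equation L X)),
      E.Finite ∧ V.IsPresentation a E := by
  constructor
  · rintro ⟨hA, X, hX, p, hp, hc⟩
    have hF := V.isPresentation_free X
    obtain ⟨E, hE, hk⟩ := hF.exists_finite_eq_cg hc
    refine ⟨X, hX, p ∘ ((V.freeCongruence X).proj ∘ termVar), E, hE, hA, fun b => ?_, fun e => ?_⟩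
    · obtain ⟨c, rfl⟩ := hp b
      obtain ⟨t, rfl⟩ := hF.exists_realize_eq c
      exact ⟨t, HomClass.realize_term _⟩
    · have := hF.rel_cg_iff E e
      rw [← hk, empty_union] at this
      rw [← this, Congruence.satisfies_comp_iff_ker]
  · rintro ⟨X, hX, a, E, hE, h⟩
    have hF := V.isPresentation_free X
    obtain ⟨p, hp⟩ := hF.exists_lift h.mem a (by simp)
    refine ⟨h.mem, X, hX, p, fun b => ?_, ?_⟩
    · obtain ⟨t, rfl⟩ := h.exists_realize_eq b
      exact ⟨t.realize ((V.freeCongruence X).proj ∘ termVar), by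
        rw [← HomClass.realize_term, hp]⟩
    · rw [Congruence.isCompactElement_iff]
      refine ⟨_, hE.image (Equation.eval ((V.freeCongruence X).proj ∘ termVar)),
        Congruence.ext_r fun b c => ?_⟩
      obtain ⟨s, rfl⟩ := hF.exists_realize_eq b
      obtain ⟨t, rfl⟩ := hF.exists_realize_eq c
      rw [hF.rel_cg_iff E (s, t), empty_union, ← h.satisfies_iff, ← hp,
        Congruence.satisfies_comp_iff_ker]

/-! ### Transferable injections versus amalgamation and congruence extension -/

/-- Injections are transferable in `V`: every span consisting of an injective homomorphism `i` and
a homomorphism `j` is completed in `V` by an injective homomorphism parallel to `i`. -/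
def InjectionsTransferable (V : Variety L) : Prop :=
  ∀ (A B C : Type u) [L.Structure A] [L.Structure B] [L.Structure C],
    V.Mem A → V.Mem B → V.Mem C → ∀ (i : A →[L] B) (j : A →[L] C), Function.Injective i →
      ∃ (D : Type u) (_ : L.Structure D) (h : B →[L] D) (k : C →[L] D),
        V.Mem D ∧ Function.Injective k ∧ ∀ a, h (i a) = k (j a)

section Transferable

variable [L.IsAlgebraic]

/-- Transfer the inclusion of `S` along `S → S/θ`. Since `S/θ` stays embedded, the kernel of the
resulting map on `A` restricts to exactly `θ`. -/
theorem InjectionsTransferable.congruenceExtension (hV : V.InjectionsTransferable) :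
    V.CongruenceExtension := by
  intro A _ hA S θ
  have hS : V.Mem S := hA.of_injective S.subtype.toHom S.subtype.injective
  obtain ⟨D, _, h, k, -, hk, hc⟩ := hV S A θ.Quot hS hA
    (hS.of_surjective θ.proj θ.proj_surjective) S.subtype.toHom θ.proj S.subtype.injective
  refine ⟨Congruence.ker h, fun a b => ?_⟩
  rw [← θ.proj_eq_iff, ← hk.eq_iff, ← hc, ← hc]
  rfl

theorem exists_prod {A B : Type u} [L.Structure A] [L.Structure B] (hA : V.Mem A)
    (hB : V.Mem B) : ∃ _ : L.Structure (A × B), V.Mem (A × B) ∧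
      ∀ (C : Type u) [L.Structure C] (f : C →[L] A) (g : C →[L] B),
        ∃ h : C →[L] A × B, ∀ c, h c = (f c, g c) := by
  let s : L.Structure (A × B) :=
    { funMap := fun F x => (Structure.funMap F (Prod.fst ∘ x), Structure.funMap F (Prod.snd ∘ x))
      RelMap := fun r => isEmptyElim r }
  let p : (A × B) →[L] A := ⟨Prod.fst, fun _ _ => rfl, fun r => isEmptyElim r⟩
  let q : (A × B) →[L] B := ⟨Prod.snd, fun _ _ => rfl, fun r => isEmptyElim r⟩
  refine ⟨s, fun e he f => ?_, fun C _ f g => ?_⟩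
  · have hp := hA e he (p ∘ f)
    have hq := hB e he (q ∘ f)
    simp only [Satisfies, HomClass.realize_term] at hp hq ⊢
    exact Prod.ext hp hq
  · refine ⟨⟨fun c => (f c, g c), fun F x => ?_, fun r => isEmptyElim r⟩, fun _ => rfl⟩
    exact Prod.ext (f.map_fun F x) (g.map_fun F x)

/-- A transfer makes only one leg injective. Transferring each embedding along the other and pairing
the two squares in a product makes both legs injective. -/
theorem InjectionsTransferable.amalgamation (hV : V.InjectionsTransferable) : V.Amalgamation := by
  intro A B C _ _ _ hA hB hC i j
  obtain ⟨D, _, h, k, hD, hk, hc⟩ := hV A B C hA hB hC i.toHom j.toHom i.injective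
  obtain ⟨D', _, h', k', hD', hk', hc'⟩ := hV A C B hA hC hB j.toHom i.toHom j.injective
  obtain ⟨_, hE, hprod⟩ := exists_prod hD hD'
  obtain ⟨f, hf⟩ := hprod B h k'
  obtain ⟨g, hg⟩ := hprod C k h'
  have hfi : Function.Injective f := fun x y hxy => hk' (by simpa [hf] using congrArg Prod.snd hxy)
  have hgi : Function.Injective g := fun x y hxy => hk (by simpa [hg] using congrArg Prod.fst hxy)
  refine ⟨D × D', _, Embedding.ofInjective hfi, Embedding.ofInjective hgi, hE, ?_⟩
  ext a : 1
  exact (hf _).trans ((Prod.ext (hc a) (hc' a).symm).trans (hg _).symm)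

/-- Extend the kernel of `j`, carried to the image of `i`, to a congruence `φ` on `B`. The image of
`j` then embeds in both `B/φ` and `C`, and these are amalgamated over it. -/
theorem injectionsTransferable_of_amalgamation (hap : V.Amalgamation)
    (hcep : V.CongruenceExtension) : V.InjectionsTransferable := by
  intro A B C _ _ _ hA hB hC i j hi
  obtain ⟨j', hj'⟩ := Congruence.exists_lift_of_surjective
    (i.codRestrict i.range i.mem_range_self)
    (by rintro ⟨_, a, rfl⟩; exact ⟨a, rfl⟩) j
    (fun a b hab => congrArg j (hi (congrArg Subtype.val hab)))
  obtain ⟨φ, hφ⟩ := hcep B hB i.range (Congruence.ker j')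
  have key : ∀ a b, φ.r (i a) (i b) ↔ j a = j b := fun a b => by
    rw [← hj', ← hj']
    exact hφ (i.codRestrict i.range i.mem_range_self a)
      (i.codRestrict i.range i.mem_range_self b)
  let q : A →[L] j.range := j.codRestrict j.range j.mem_range_self
  have hq : Function.Surjective q := by rintro ⟨_, a, rfl⟩; exact ⟨a, rfl⟩
  obtain ⟨m, hm⟩ := Congruence.exists_lift_of_surjective q hq (φ.proj.comp i)
    (fun a b hab => φ.proj_eq_iff.2 ((key a b).2 (congrArg Subtype.val hab)))
  have hmi : Function.Injective m := fun x y hxy => by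
    obtain ⟨a, rfl⟩ := hq x
    obtain ⟨b, rfl⟩ := hq y
    rw [hm, hm] at hxy
    exact Subtype.ext ((key a b).1 (φ.proj_eq_iff.1 hxy))
  obtain ⟨D, _, h, k, hD, hc⟩ := hap j.range φ.Quot C
    (hC.of_injective j.range.subtype.toHom j.range.subtype.injective)
    (hB.of_surjective φ.proj φ.proj_surjective) hC (Embedding.ofInjective hmi) j.range.subtype
  refine ⟨D, _, h.toHom.comp φ.proj, k.toHom, hD, k.injective, fun a => ?_⟩
  have := DFunLike.congr_fun hc (q a)
  exact (congrArg h (hm a)).symm.trans this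

end Transferable

/-! ### Finitely many variables and split assignments -/

/-- A finite set of equations involves only finitely many variables, and can be pulled back along
any map whose range contains these. -/
theorem exists_finite_vars {X : Type w} (G : Set (Equation L X)) (hG : G.Finite) :
    ∃ U : Set X, U.Finite ∧ ∀ {Y : Type w'} (g : Y → X), U ⊆ range g →
      ∃ H : Set (Equation L Y), H.Finite ∧ Equation.rename g '' H = G := by
  classical
  refine ⟨⋃ e ∈ G, (e.1.varFinset ∪ e.2.varFinset : Finset X),
    hG.biUnion fun e _ => Finset.finite_toSet _, fun {Y} g hU => ?_⟩
  have hterm : ∀ t : L.Term X, (t.varFinset : Set X) ⊆ range g → ∃ s : L.Term Y,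
      s.relabel g = t := by
    intro t
    induction t with
    | var x =>
      intro h
      obtain ⟨y, rfl⟩ := h (show x ∈ _ by simp [Term.varFinset])
      exact ⟨Term.var y, rfl⟩
    | func f ts ih =>
      intro h
      choose s hs using fun i => ih i (Subset.trans (by
        intro x hx
        simp only [Term.varFinset, Finset.coe_biUnion, mem_iUnion]
        exact ⟨i, by simp, hx⟩) h)
      exact ⟨Term.func f s, by simp [Term.relabel, hs]⟩
  have hsub : G ⊆ Equation.rename g '' univ := by
    intro e he
    obtain ⟨s, hs⟩ := hterm e.1 fun x hx => hU (mem_biUnion he (by simp_all))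
    obtain ⟨t, ht⟩ := hterm e.2 fun x hx => hU (mem_biUnion he (by simp_all))
    exact ⟨(s, t), trivial, Prod.ext hs ht⟩
  obtain ⟨H, -, hH, hHG⟩ := exists_subset_image_finite_and.1 ⟨G, hsub, hG, (rfl : G = G)⟩
  exact ⟨H, hH, hHG.symm⟩

theorem exists_finite_subset_of_subset_image_union {α β γ : Type*} {f : α → γ} {g : β → γ}
    {s : Set α} {t : Set β} {T : Set γ} (hT : T ⊆ f '' s ∪ g '' t) (hfin : T.Finite) :
    ∃ s' ⊆ s, ∃ t' ⊆ t, s'.Finite ∧ t'.Finite ∧ T ⊆ f '' s' ∪ g '' t' := by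
  obtain ⟨s', hs, hs', h₁⟩ := exists_subset_image_finite_and.1
    ⟨T ∩ f '' s, inter_subset_right, hfin.inter_of_left _, subset_rfl (a := T ∩ f '' s)⟩
  obtain ⟨t', ht, ht', h₂⟩ := exists_subset_image_finite_and.1
    ⟨T ∩ g '' t, inter_subset_right, hfin.inter_of_left _, subset_rfl (a := T ∩ g '' t)⟩
  exact ⟨s', hs, t', ht, hs', ht', fun x hx => (hT hx).imp (fun h => h₁ ⟨hx, h⟩) fun h => h₂ ⟨hx, h⟩⟩
theorem entails_rename_union_iff {X Y Z : Type u} {G : Set (Equation L (X ⊕ Y))}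
    {S D : Set (Equation L (Y ⊕ Z))} :
    V.Entails
        (Equation.rename (Sum.map id Sum.inl : X ⊕ Y → X ⊕ (Y ⊕ Z)) '' G ∪
          Equation.rename (Sum.inr : Y ⊕ Z → X ⊕ (Y ⊕ Z)) '' S)
        (Equation.rename (Sum.inr : Y ⊕ Z → X ⊕ (Y ⊕ Z)) '' D) ↔
      ∀ (A : Type u) [L.Structure A], V.Mem A → ∀ (x : X → A) (y : Y → A) (z : Z → A),
        (∀ e ∈ G, Satisfies A (Sum.elim x y) e) → (∀ e ∈ S, Satisfies A (Sum.elim y z) e) →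
          ∀ e ∈ D, Satisfies A (Sum.elim y z) e := by
  have key : ∀ {A : Type u} (x : X → A) (y : Y → A) (z : Z → A),
      Sum.elim x (Sum.elim y z) ∘ Sum.map id Sum.inl = Sum.elim x y := by
    intro A x y z
    ext (_ | _) <;> rfl
  simp only [Entails, union_def, mem_ofPred_eq, or_imp, forall_and, forall_mem_image,
    satisfies_rename, and_imp]
  refine forall₃_congr fun A _ hA => ⟨fun h x y z => ?_, fun h f => ?_⟩
  · have := @h (Sum.elim x (Sum.elim y z))
    rwa [key, Sum.elim_comp_inr] at this
  · obtain ⟨x, f, rfl⟩ : ∃ x f', f = Sum.elim x f' := ⟨_, _, (Sum.elim_comp_inl_inr f).symm⟩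
    obtain ⟨y, z, rfl⟩ : ∃ y z, f = Sum.elim y z := ⟨_, _, (Sum.elim_comp_inl_inr f).symm⟩
    rw [key, Sum.elim_comp_inr]
    exact h x y z

theorem entails_rename_inr_iff {X Y : Type u} {G : Set (Equation L (X ⊕ Y))}
    {P : Set (Equation L Y)} :
    V.Entails G (Equation.rename (Sum.inr : Y → X ⊕ Y) '' P) ↔
      ∀ (A : Type u) [L.Structure A], V.Mem A → ∀ (x : X → A) (y : Y → A),
        (∀ e ∈ G, Satisfies A (Sum.elim x y) e) → ∀ e ∈ P, Satisfies A y e := by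
  simp only [Entails, forall_mem_image, satisfies_rename]
  refine forall₃_congr fun A _ hA => ⟨fun h x y => ?_, fun h f => ?_⟩
  · exact @h (Sum.elim x y)
  · obtain ⟨x, y, rfl⟩ : ∃ x y, f = Sum.elim x y := ⟨_, _, (Sum.elim_comp_inl_inr f).symm⟩
    exact h x y

theorem leftUniformMaehara_iff : V.LeftUniformMaehara ↔
    ∀ (Y Z : Type u) [Finite Y] [Finite Z] (S D : Set (Equation L (Y ⊕ Z))),
      S.Finite → D.Finite →
      ∃ P : Set (Equation L Y), P.Finite ∧
        ∀ (X : Type u) (G : Set (Equation L (X ⊕ Y))), G.Finite →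
          ((∀ (A : Type u) [L.Structure A], V.Mem A → ∀ (x : X → A) (y : Y → A) (z : Z → A),
              (∀ e ∈ G, Satisfies A (Sum.elim x y) e) →
                (∀ e ∈ S, Satisfies A (Sum.elim y z) e) → ∀ e ∈ D, Satisfies A (Sum.elim y z) e) ↔
            ∀ (A : Type u) [L.Structure A], V.Mem A → ∀ (x : X → A) (y : Y → A),
              (∀ e ∈ G, Satisfies A (Sum.elim x y) e) → ∀ e ∈ P, Satisfies A y e) := by
  simp only [← entails_rename_union_iff, ← entails_rename_inr_iff]
  rfl

/-- An assignment satisfying the diagram of an algebra induces a homomorphism. -/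
theorem exists_hom_of_satisfies [L.IsAlgebraic] {X : Type*} {B D : Type*} [L.Structure B] [L.Structure D]
    (a : X → B) (ha : Function.Surjective a) (d : X → D)
    (h : ∀ e : Equation L X, Satisfies B a e → Satisfies D d e) :
    ∃ g : B →[L] D, ∀ x, g (a x) = d x := by
  have hs := Function.surjInv_eq ha
  refine ⟨⟨d ∘ Function.surjInv ha, fun F x => ?_, fun r => isEmptyElim r⟩, fun x => ?_⟩
  · refine h (Term.var _, Term.func F fun i => Term.var (Function.surjInv ha (x i))) ?_
    simp only [Satisfies, Term.realize, hs]
  · exact h (Term.var _, Term.var x) (hs (a x))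

/-- The second clause comes from testing the uniform `P` against itself: no `x`-variables, and `P`
as the premises. -/
theorem LeftUniformMaehara.exists_interpolant (hV : V.LeftUniformMaehara) {X Y Z : Type u}
    [Finite Y] [Finite Z] {G : Set (Equation L (X ⊕ Y))} {S D : Set (Equation L (Y ⊕ Z))}
    (hG : G.Finite) (hS : S.Finite) (hD : D.Finite)
    (h : ∀ (A : Type u) [L.Structure A], V.Mem A → ∀ (x : X → A) (y : Y → A) (z : Z → A),
        (∀ e ∈ G, Satisfies A (Sum.elim x y) e) → (∀ e ∈ S, Satisfies A (Sum.elim y z) e) →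
          ∀ e ∈ D, Satisfies A (Sum.elim y z) e) :
    ∃ P : Set (Equation L Y),
      (∀ (A : Type u) [L.Structure A], V.Mem A → ∀ (x : X → A) (y : Y → A),
        (∀ e ∈ G, Satisfies A (Sum.elim x y) e) → ∀ e ∈ P, Satisfies A y e) ∧
      (∀ (A : Type u) [L.Structure A], V.Mem A → ∀ (y : Y → A) (z : Z → A),
        (∀ e ∈ P, Satisfies A y e) → (∀ e ∈ S, Satisfies A (Sum.elim y z) e) →
          ∀ e ∈ D, Satisfies A (Sum.elim y z) e) := by
  obtain ⟨P, hP, hiff⟩ := leftUniformMaehara_iff.1 hV Y Z S D hS hD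
  refine ⟨P, (hiff X G hG).1 h, fun A _ hA y z hp => ?_⟩
  refine (hiff PEmpty (Equation.rename Sum.inr '' P) (hP.image _)).2 ?_ A hA PEmpty.elim y z ?_
  · intro A _ hA x y hp e he
    simpa [satisfies_rename] using hp _ (mem_image_of_mem _ he)
  · rintro _ ⟨e, he, rfl⟩
    simpa [satisfies_rename] using hp e he

/-! ### Interpolation and transferable injections -/

theorem LeftUniformMaehara.injectionsTransferable [L.IsAlgebraic] [Nonempty L.Constants]
    (hV : V.LeftUniformMaehara) : V.InjectionsTransferable := by
  intro A B C _ _ _ hA hB hC i j hi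
  let Γ : Set (Equation L (B ⊕ A)) := {e | Satisfies B (Sum.elim id i) e}
  let Δ : Set (Equation L (A ⊕ C)) := {e | Satisfies C (Sum.elim j id) e}
  let p : B ⊕ A → B ⊕ (A ⊕ C) := Sum.map id Sum.inl
  let q : A ⊕ C → B ⊕ (A ⊕ C) := Sum.inr
  -- The diagrams `Γ` of `B` and `Δ` of `C` share the variables from `A`; the algebra presented by
  -- their union completes the span.
  let T := Equation.rename (L := L) p '' Γ ∪ Equation.rename q '' Δ
  have hP := V.isPresentation_entailedCongruence T
  generalize hd : (V.entailedCongruence T).proj ∘ termVar = d at hP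
  obtain ⟨h, hh⟩ := exists_hom_of_satisfies (Sum.elim id i) (fun b => ⟨.inl b, rfl⟩) (d ∘ p)
    fun e he => (satisfies_rename d p e).1 (hP.satisfies (.inl ⟨e, he, rfl⟩))
  obtain ⟨k, hk⟩ := exists_hom_of_satisfies (Sum.elim j id) (fun c => ⟨.inr c, rfl⟩) (d ∘ q)
    fun e he => (satisfies_rename d q e).1 (hP.satisfies (.inr ⟨e, he, rfl⟩))
  refine ⟨_, _, h, k, hP.mem, fun c c' hcc => ?_, fun a => (hh (.inr a)).trans (hk (.inl a)).symm⟩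
  have hcd : d (q (.inr c)) = d (q (.inr c')) := (hk (.inr c)).symm.trans (hcc.trans (hk (.inr c')))
  obtain ⟨T₀, hT₀, hfin, hent⟩ :=
    ((hP.satisfies_iff (Term.var (q (.inr c)), Term.var (q (.inr c')))).1 hcd).exists_finite
  obtain ⟨G, hGΓ, S, hSΔ, hG, hS, hT⟩ := exists_finite_subset_of_subset_image_union hT₀ hfin
  obtain ⟨U, hU, hUG⟩ := exists_finite_vars G hG
  obtain ⟨W, hW, hWS⟩ := exists_finite_vars S hS
  -- `Y` collects the elements of `A` occurring in `G` or `S`, and `Z` those of `C` occurring in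
  -- `S`, together with `c` and `c'`.
  let Y : Set A := Sum.inr ⁻¹' U ∪ Sum.inl ⁻¹' W
  let Z : Set C := Sum.inr ⁻¹' W ∪ {c, c'}
  have : Finite Y := ((hU.preimage Sum.inr_injective.injOn).union
    (hW.preimage Sum.inl_injective.injOn)).to_subtype
  have : Finite Z := ((hW.preimage Sum.inr_injective.injOn).union (toFinite {c, c'})).to_subtype
  obtain ⟨G', hG', rfl⟩ := hUG (Sum.map id Subtype.val : B ⊕ Y → B ⊕ A) (by
    rintro (b | a) h
    · exact ⟨.inl b, rfl⟩
    · exact ⟨.inr ⟨a, .inl h⟩, rfl⟩)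
  obtain ⟨S', hS', rfl⟩ := hWS (Sum.map Subtype.val Subtype.val : Y ⊕ Z → A ⊕ C) (by
    rintro (a | c) h
    · exact ⟨.inl ⟨a, .inr h⟩, rfl⟩
    · exact ⟨.inr ⟨c, .inl h⟩, rfl⟩)
  obtain ⟨P, hP₁, hP₂⟩ := hV.exists_interpolant hG' hS' (finite_singleton
    ((Term.var (.inr ⟨c, by simp [Z]⟩), Term.var (.inr ⟨c', by simp [Z]⟩)) : Equation L (Y ⊕ Z))) (by
      rintro E _ hE x y z hx hz _ rfl
      -- A constant symbol makes `E` nonempty, so assignments on `Y` and `Z` extend to all of `A`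
      -- and `C`, where `hent` applies.
      have : Nonempty E := nonempty_of_nonempty_constants L E
      obtain ⟨y, rfl⟩ : ∃ y' : A → E, y' ∘ Subtype.val = y :=
        ⟨Function.extend Subtype.val y fun _ => Classical.arbitrary E,
          funext (Subtype.val_injective.extend_apply y _)⟩
      obtain ⟨z, rfl⟩ : ∃ z' : C → E, z' ∘ Subtype.val = z :=
        ⟨Function.extend Subtype.val z fun _ => Classical.arbitrary E,
          funext (Subtype.val_injective.extend_apply z _)⟩
      refine hent E hE (Sum.elim x (Sum.elim y z)) (fun e he => ?_) _ rfl
      obtain ⟨_, ⟨e, he', rfl⟩, rfl⟩ | ⟨_, ⟨e, he', rfl⟩, rfl⟩ := hT he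
      · rw [satisfies_rename, satisfies_rename]
        convert hx e he' using 1
        ext (_ | _) <;> rfl
      · rw [satisfies_rename, satisfies_rename]
        convert hz e he' using 1
        ext (_ | _) <;> rfl)
  have hPB : ∀ e ∈ P, Satisfies B (i ∘ Subtype.val) e := hP₁ B hB id _ fun e he => by
    have := (satisfies_rename _ _ _).1 (hGΓ ⟨e, he, rfl⟩)
    convert this using 1
    ext (_ | _) <;> rfl
  have hPA : ∀ e ∈ P, Satisfies A Subtype.val e := fun e he =>
    (satisfies_comp_iff _ e hi).1 (hPB e he)
  exact hP₂ C hC (j ∘ Subtype.val) Subtype.val (fun e he => (hPA e he).map j) (fun e he => by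
    have := (satisfies_rename _ _ _).1 (hSΔ ⟨e, he, rfl⟩)
    convert this using 1
    ext (_ | _) <;> rfl) _ rfl

theorem InjectionsTransferable.exists_interpolant [L.IsAlgebraic] (hV : V.InjectionsTransferable) {X Y Z : Type u}
    {G : Set (Equation L (X ⊕ Y))} {S D : Set (Equation L (Y ⊕ Z))} (hD : D.Finite)
    (h : ∀ (A : Type u) [L.Structure A], V.Mem A → ∀ (x : X → A) (y : Y → A) (z : Z → A),
        (∀ e ∈ G, Satisfies A (Sum.elim x y) e) → (∀ e ∈ S, Satisfies A (Sum.elim y z) e) →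
          ∀ e ∈ D, Satisfies A (Sum.elim y z) e) :
    ∃ P : Set (Equation L Y), P.Finite ∧
      (∀ (A : Type u) [L.Structure A], V.Mem A → ∀ (x : X → A) (y : Y → A),
        (∀ e ∈ G, Satisfies A (Sum.elim x y) e) → ∀ e ∈ P, Satisfies A y e) ∧
      (∀ (A : Type u) [L.Structure A], V.Mem A → ∀ (y : Y → A) (z : Z → A),
        (∀ e ∈ P, Satisfies A y e) → (∀ e ∈ S, Satisfies A (Sum.elim y z) e) →
          ∀ e ∈ D, Satisfies A (Sum.elim y z) e) := by
  -- All `y`-consequences of `G`, possibly infinitely many; finitarity cuts them down at the end.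
  let P : Set (Equation L Y) := {e | V.Entails G {e.rename Sum.inr}}
  have hGP : ∀ (A : Type u) [L.Structure A], V.Mem A → ∀ (x : X → A) (y : Y → A),
      (∀ e ∈ G, Satisfies A (Sum.elim x y) e) → ∀ e ∈ P, Satisfies A y e := by
    intro A _ hA x y hxy e he
    simpa [satisfies_rename] using he A hA _ hxy _ rfl
  have hent : V.Entails (Equation.rename (Sum.inl : Y → Y ⊕ Z) '' P ∪ S) D := by
    intro C _ hC c hc
    have hB := V.isPresentation_entailedCongruence G
    have hA := V.isPresentation_entailedCongruence P
    obtain ⟨i, hi⟩ := hA.exists_lift hB.mem ((V.entailedCongruence G).proj ∘ termVar ∘ Sum.inr)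
      (hGP _ hB.mem ((V.entailedCongruence G).proj ∘ termVar ∘ Sum.inl) _ fun e he => by
        have := hB.satisfies he
        convert this using 1
        ext (_ | _) <;> rfl)
    obtain ⟨j, hj⟩ := hA.exists_lift hC (c ∘ Sum.inl) fun e he =>
      (satisfies_rename _ _ _).1 (hc _ (.inl ⟨e, he, rfl⟩))
    -- An equation in `Y` that follows from `G` belongs to `P` by definition, so it already holds in
    -- the algebra presented by `P`.
    have hinj : Function.Injective i := by
      intro a a' haa
      obtain ⟨s, rfl⟩ := hA.exists_realize_eq a
      obtain ⟨t, rfl⟩ := hA.exists_realize_eq a'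
      rw [← HomClass.realize_term, ← HomClass.realize_term, hi] at haa
      exact hA.satisfies (e := (s, t)) ((hB.satisfies_iff _).1 ((satisfies_rename _ _ _).2 haa))
    obtain ⟨E, _, g, k, hE, hk, hgk⟩ := hV _ _ C hA.mem hB.mem hC i j hinj
    have hy : ∀ y, g ((V.entailedCongruence G).proj (termVar (Sum.inr y))) = k (c (Sum.inl y)) :=
      fun y => by
        have h₁ := hgk ((V.entailedCongruence P).proj (termVar y))
        exact (congrArg g (congrFun hi y)).symm.trans (h₁.trans (congrArg k (congrFun hj y)))
    have hcomp : Sum.elim (k ∘ c ∘ Sum.inl) (k ∘ c ∘ Sum.inr) = k ∘ c := by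
      ext (_ | _) <;> rfl
    have := h E hE (g ∘ (V.entailedCongruence G).proj ∘ termVar ∘ Sum.inl) (k ∘ c ∘ Sum.inl)
      (k ∘ c ∘ Sum.inr) (fun e he => by
        convert (hB.satisfies he).map g using 1
        ext (x | y)
        · rfl
        · exact (hy y).symm) (fun e he => by
        rw [hcomp]
        exact (hc e (.inr he)).map k)
    intro e he
    have := this e he
    rwa [hcomp, satisfies_comp_iff _ _ hk] at this
  obtain ⟨T, hT, hfin, hTD⟩ := hent.exists_finite_of_finite hD
  obtain ⟨P', hP', S', hS', hPf, -, hsub⟩ := exists_finite_subset_of_subset_image_union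
    (f := Equation.rename Sum.inl) (s := P) (g := id) (t := S) (by rwa [image_id]) hfin
  refine ⟨P', hPf, fun A _ hA x y hxy e he => hGP A hA x y hxy e (hP' he),
    fun A _ hA y z hy hz => hTD A hA _ fun e he => ?_⟩
  obtain ⟨e, he', rfl⟩ | ⟨e, he', rfl⟩ := hsub he
  · exact (satisfies_rename _ _ _).2 (hy e he')
  · exact hz e (hS' he')

/-! ### Left adjoints and uniformity -/

theorem IsPresentation.cg_le_cg_iff [L.IsAlgebraic] {X : Type u} {A : Type u} [L.Structure A]
    {a : X → A} {E : Set (Equation L X)} (h : V.IsPresentation a E) (S T : Set (Equation L X)) :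
    Congruence.cg (L := L) (Equation.eval a '' S) ≤ Congruence.cg (Equation.eval a '' T) ↔
      V.Entails (E ∪ T) S := by
  rw [Congruence.cg_le_iff, forall_mem_image, entails_iff_forall_singleton]
  exact forall₂_congr fun e _ => h.rel_cg_iff T e

/-- Substitute terms for the variables of an equation. -/
def _root_.UnivAlg.Equation.subst {X : Type w} {Y : Type w'} (t : X → L.Term Y) (e : Equation L X) :
    Equation L Y :=
  (e.1.subst t, e.2.subst t)

theorem satisfies_subst {X : Type w} {Y : Type w'} {A : Type*} [L.Structure A] (f : Y → A)
    (t : X → L.Term Y) (e : Equation L X) :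
    Satisfies A f (e.subst t) ↔ Satisfies A (fun x => (t x).realize f) e := by
  simp [Satisfies, Equation.subst, Term.realize_subst]

theorem map_cg_eval {X : Type w} {Y : Type w'} {A B : Type*} [L.Structure A] [L.Structure B]
    (f : A →[L] B) {a : X → A} {b : Y → B} {t : X → L.Term Y}
    (ht : ∀ x, (t x).realize b = f (a x)) (S : Set (Equation L X)) :
    Congruence.map f (Congruence.cg (Equation.eval a '' S)) =
      Congruence.cg (Equation.eval b '' (Equation.subst t '' S)) := by
  rw [Congruence.map_cg, image_image, image_image]
  congr 2
  ext e : 1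
  simp only [Equation.eval, Equation.subst, Term.realize_subst, ht, Prod.map]
  exact Prod.ext (HomClass.realize_term f).symm (HomClass.realize_term f).symm

theorem LeftUniformMaehara.compactLiftingsHaveLeftAdjoints [L.IsAlgebraic]
    (hV : V.LeftUniformMaehara) : V.CompactLiftingsHaveLeftAdjoints := by
  intro A B _ _ hA hB f
  obtain ⟨Y, _, a, E, hE, ha⟩ := finitelyPresented_iff.1 hA
  obtain ⟨Z, _, b, F, hF, hb⟩ := finitelyPresented_iff.1 hB
  choose t ht using fun y => hb.exists_realize_eq (f (a y))
  suffices h : ∀ θ : KCon L B, ∃ φ : KCon L A, ∀ ψ, φ ≤ ψ ↔ θ ≤ compactLifting f ψ by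
    choose g hg using h
    exact ⟨g, hg⟩
  rintro ⟨θ, hθ⟩
  obtain ⟨D, hD, rfl⟩ := hb.exists_finite_eq_cg hθ
  -- The premises are the graph `y = t(z)` of `f` on generators and the relations `F` of `B`; the
  -- conclusion `D` generates `θ`.
  obtain ⟨P, hP, hiff⟩ := leftUniformMaehara_iff.1 hV Y Z
    (range (fun y => ((Term.var (.inl y), (t y).relabel Sum.inr) : Equation L (Y ⊕ Z))) ∪
      Equation.rename Sum.inr '' F) (Equation.rename Sum.inr '' D)
    ((finite_range _).union (hF.image _)) (hD.image _)
  refine ⟨⟨_, Congruence.isCompactElement_cg (hP.image (Equation.eval a))⟩, ?_⟩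
  rintro ⟨ψ, hψ⟩
  obtain ⟨G, hG, rfl⟩ := ha.exists_finite_eq_cg hψ
  have h := hiff PEmpty (Equation.rename Sum.inr '' (E ∪ G)) ((hE.union hG).image _)
  change Congruence.cg _ ≤ Congruence.cg _ ↔ Congruence.cg _ ≤ Congruence.map f (Congruence.cg _)
  rw [map_cg_eval f ht, ha.cg_le_cg_iff, hb.cg_le_cg_iff]
  simp only [forall_mem_image, satisfies_rename, Sum.elim_comp_inr, union_def, mem_ofPred_eq,
    or_imp, forall_and, forall_mem_range] at h
  constructor
  · intro hGP C _ hC z hz e he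
    refine h.2 (fun D _ hD _ y hy => hGP D hD y fun d hd => hd.elim (hy.1 d) (hy.2 d)) C hC
      PEmpty.elim (fun y => (t y).realize z) z ⟨fun d hd => ?_, fun d hd => ?_⟩
      ⟨fun y => ?_, fun d hd => hz d (.inl hd)⟩ he
    -- The relations `E` of `A` at `t(z)` follow from `F`, since `f` is a homomorphism.
    · refine (satisfies_subst z t d).1 ((hb.satisfies_iff (d.subst t)).1 ?_ C hC z
        (fun e he => hz e (.inl he)) _ rfl)
      rw [satisfies_subst, funext ht]
      exact (ha.satisfies hd).map f
    · exact (satisfies_subst z t d).1 (hz _ (.inr ⟨d, hd, rfl⟩))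
    · simp [Satisfies, Term.realize_relabel]
  · intro hGD C _ hC y hy e he
    refine h.1 (fun C _ hC _ y z hy hz e he => hGD C hC z (fun d hd => ?_) e he) C hC PEmpty.elim y
      ⟨fun d hd => hy d (.inl hd), fun d hd => hy d (.inr hd)⟩ e he
    obtain hd | ⟨d, hd, rfl⟩ := hd
    · exact hz.2 hd
    · rw [satisfies_subst]
      convert hy.2 d hd using 1
      ext x
      simpa [Satisfies, Term.realize_relabel] using (hz.1 x).symm

theorem InjectionsTransferable.leftUniformMaehara [L.IsAlgebraic] (hV : V.InjectionsTransferable)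
    (hadj : V.CompactLiftingsHaveLeftAdjoints) : V.LeftUniformMaehara := by
  rw [leftUniformMaehara_iff]
  intro Y Z _ _ S D hS hD
  have ha := V.isPresentation_entailedCongruence (X := Y) ∅
  have hb := V.isPresentation_entailedCongruence S
  generalize (V.entailedCongruence ∅).proj ∘ termVar = a at ha
  generalize (V.entailedCongruence S).proj ∘ termVar = b at hb
  -- The homomorphism from the free algebra on `Y` to the algebra presented by `S`; `P` will
  -- generate the left adjoint's value at the congruence of `D`.
  obtain ⟨f, hf⟩ := ha.exists_lift hb.mem (b ∘ Sum.inl) (by simp)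
  obtain ⟨g, hg⟩ := hadj _ _
    (finitelyPresented_iff.2 ⟨Y, inferInstance, a, ∅, finite_empty, ha⟩)
    (finitelyPresented_iff.2 ⟨Y ⊕ Z, inferInstance, b, S, hS, hb⟩) f
  obtain ⟨P, hP, hgP⟩ := ha.exists_finite_eq_cg
    (g ⟨_, Congruence.isCompactElement_cg (hD.image (Equation.eval b))⟩).2
  have key : ∀ Q : Set (Equation L Y), Q.Finite →
      (V.Entails Q P ↔ V.Entails (S ∪ Equation.subst (Term.var ∘ Sum.inl) '' Q) D) := by
    intro Q hQ
    have h := hg ⟨_, Congruence.isCompactElement_cg (hD.image (Equation.eval b))⟩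
      ⟨_, Congruence.isCompactElement_cg (hQ.image (Equation.eval a))⟩
    rw [← Subtype.coe_le_coe, hgP] at h
    change Congruence.cg _ ≤ Congruence.cg _ ↔
      Congruence.cg _ ≤ Congruence.map f (Congruence.cg _) at h
    rwa [map_cg_eval f (t := Term.var ∘ Sum.inl) (fun y => (congrFun hf y).symm), ha.cg_le_cg_iff,
      hb.cg_le_cg_iff, empty_union] at h
  have hPD : ∀ (A : Type u) [L.Structure A], V.Mem A → ∀ (y : Y → A) (z : Z → A),
      (∀ e ∈ P, Satisfies A y e) → (∀ e ∈ S, Satisfies A (Sum.elim y z) e) →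
        ∀ e ∈ D, Satisfies A (Sum.elim y z) e := by
    intro A _ hA y z hy hz
    refine (key P hP).1 (fun _ _ _ _ h => h) A hA _ ?_
    rintro _ (he | ⟨e, he, rfl⟩)
    · exact hz _ he
    · exact (satisfies_subst _ _ _).2 (hy e he)
  refine ⟨P, hP, fun X G _ => ⟨fun h A _ hA x y hxy => ?_, fun h A _ hA x y z hxy hyz =>
    hPD A hA y z (h A hA x y hxy) hyz⟩⟩
  -- The adjunction only sees premises in `Y`, so `G` is replaced by an interpolant `Q`, which
  -- entails `P` by `key`.
  obtain ⟨Q, hQ, hGQ, hQD⟩ := hV.exists_interpolant hD h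
  refine (key Q hQ).2 (fun C _ hC c hc => ?_) A hA y (hGQ A hA x y hxy)
  obtain ⟨y, z, rfl⟩ : ∃ y z, c = Sum.elim y z := ⟨_, _, (Sum.elim_comp_inl_inr c).symm⟩
  exact hQD C hC y z (fun e he => (satisfies_subst _ _ _).1 (hc _ (.inr ⟨e, he, rfl⟩)))
    fun e he => hc e (.inl he)

end Variety

end UnivAlg

theorem theorem4p8 (L : FirstOrder.Language.{u, v}) [L.IsAlgebraic] [Nonempty L.Constants]
    (V : UnivAlg.Variety L) :
    V.LeftUniformMaehara ↔
      V.Amalgamation ∧ V.CongruenceExtension ∧ V.CompactLiftingsHaveLeftAdjoints :=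
  ⟨fun h => ⟨h.injectionsTransferable.amalgamation, h.injectionsTransferable.congruenceExtension,
    h.compactLiftingsHaveLeftAdjoints⟩, fun ⟨hap, hcep, hadj⟩ =>
    (UnivAlg.Variety.injectionsTransferable_of_amalgamation hap hcep).leftUniformMaehara hadj⟩
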